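/- Let $d\ge 2$, $n\ge 2$ and $m\ge 0$ be integers, let $\omega=e^{2\pi i/d}$, and let $$|G_n^{m}\rangle = Z_e^{m}|+\rangle^{\otimes n}=d^{-n/2}\sum_{q_1,\dots,q_n=0}^{d-1}\omega^{m\,q_1\cdots q_n}|q_1\dots q_n\rangle\in(\mathbb C^d)^{\otimes n}$$ be the $n$-qudit elementary hypergraph state, where $|+\rangle=d^{-1/2}\sum_{q=0}^{d-1}|q\rangle$ and $Z_e|q_1\dots q_n\rangle=\omega^{q_1\cdots q_n}|q_1\dots q_n\rangle$. A bipartition $A|B$ is a splitting of the set of $n$ qudits into two disjoint non-empty sets $A$ and $B$. For a unit vector $\psi$ put $$\alpha^{AB}(\psi)=\max|(\langle\phi^A|\otimes\langle\phi^B|)|\psi\rangle|^2,$$ the maximum being over unit vectors $\phi^A$ and $\phi^B$ of the qudits in $A$ and in $B$. Let $\alpha(\psi)=\max_{A|B}\alpha^{AB}(\psi)$ be the maximal squared overlap with pure biseparable states, and let $E(\psi)=\min_{A|B}\bigl(1-\alpha^{AB}(\psi)\bigr)$ be the multipartite entanglement. Write $d=\prod_{i\in\mathcal J}p_i^{\ell_i}$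 with distinct primes $p_i$ and $\ell_i\ge1$, and $\gcd(m,d)=\prod_{i\in\mathcal J}p_i^{k_i}$ with $0\le k_i\le\ell_i$. Then $$\alpha(|G_n^{m}\rangle)=\prod_{i\in\mathcal J}\Bigl[1-(1-\delta_{k_i,\ell_i})\Bigl(1-\frac1{p_i}\Bigr)^{n-1}\sum_{j=0}^{\ell_i-k_i-1}p_i^{-j}\binom{n+j-2}{j}\Bigr],\qquad E(|G_n^{m}\rangle)=1-\alpha(|G_n^{m}\rangle).$$ Moreover, every bipartition $A|B$ with $|A|=n-1$ and $|B|=1$ is optimal, that is, $\alpha^{AB}(|G_n^{m}\rangle)=\alpha(|G_n^{m}\rangle)$, and the square of the largest Schmidt coefficient of $|G_n^{m}\rangle$ with respect to it is also equal to $\alpha(|G_n^{m}\rangle)$. For every bipartition $A|B$, the reduced density matrix $\rho^{A}=\mathrm{Tr}_B|G_n^m\rangle\langle G_n^m|$, written in the computational basis, has infinity norm (largest absolute row sum) $\|\rho^{A}\|_\infty=\alpha(|G_n^{m}\rangle)$. -/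

import Mathlib

open scoped BigOperators

noncomputable section

namespace QuditHypergraph

/-- Strings `q = (q_i)_{i ∈ ι}` with entries in `{0, …, d-1}`: the labels of the computational
basis of a system of `d`-level qudits indexed by `ι`. -/
abbrev Str (ι : Type) (d : ℕ) : Type := ι → Fin d

/-- The Hilbert space of a system of `d`-level qudits indexed by `ι`, i.e. the tensor product of
copies of `ℂ^d`, written in the computational basis (with its Euclidean inner product). -/
abbrev Hilb (ι : Type) [Fintype ι] (d : ℕ) : Type := EuclideanSpace ℂ (Str ι d)

/-- The root of unity `ω = exp(2πi/d)`. -/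
def omega (d : ℕ) : ℂ := Complex.exp (2 * Real.pi * Complex.I / d)

/-- The one-qudit state `|+⟩ = d^{-1/2} ∑_q |q⟩`. -/
def plusLocal (d : ℕ) : EuclideanSpace ℂ (Fin d) :=
  WithLp.toLp 2 fun _ => (((Real.sqrt d)⁻¹ : ℝ) : ℂ)

/-- The global state `⊗_{i} |+⟩_i` on `n` qudits. -/
def plusState (n d : ℕ) : Hilb (Fin n) d :=
  WithLp.toLp 2 fun q => ∏ i, plusLocal d (q i)

/-- The controlled phase gate `Z_e = ∑_q ω^{∏_{i ∈ e} q_i} |q⟩⟨q|`, acting on `n` qudits. -/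
def controlledPhase (n d : ℕ) (e : Finset (Fin n)) : Module.End ℂ (Hilb (Fin n) d) where
  toFun ψ := WithLp.toLp 2 fun q => omega d ^ (∏ i ∈ e, (q i : ℕ)) * ψ q
  map_add' φ ψ := by ext q; simp [mul_add]
  map_smul' c ψ := by ext q; simp [mul_left_comm]

/-- The `n`-qudit elementary hypergraph state `Z_e^m |+⟩^{⊗ n}`, where `e` is the hyperedge that
contains all the vertices and `m` is its multiplicity. -/
def elementaryState (n d m : ℕ) : Hilb (Fin n) d :=
  (controlledPhase n d Finset.univ ^ m) (plusState n d)

/-- The product vector `|a⟩ ⊗ |b⟩`, where `a` is a vector of the qudits in `A` and `b` one of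
the qudits outside `A`. -/
def tensor {n d : ℕ} (A : Finset (Fin n)) (a : Hilb {i // i ∈ A} d) (b : Hilb {i // i ∉ A} d) :
    Hilb (Fin n) d :=
  WithLp.toLp 2 fun q => a (fun i => q i) * b (fun i => q i)

/-- `A` and its complement form a bipartition: both parts are non-empty. -/
def IsBipartition {n : ℕ} (A : Finset (Fin n)) : Prop := A.Nonempty ∧ Aᶜ.Nonempty

/-- `φ` is a pure state that is separable with respect to the bipartition `A | Aᶜ`. -/
def IsSeparable {n d : ℕ} (A : Finset (Fin n)) (φ : Hilb (Fin n) d) : Prop :=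
  ∃ (a : Hilb {i // i ∈ A} d) (b : Hilb {i // i ∉ A} d), ‖a‖ = 1 ∧ ‖b‖ = 1 ∧ φ = tensor A a b

/-- `φ` is a pure biseparable state: it is separable with respect to some bipartition. -/
def IsBiseparable {n d : ℕ} (φ : Hilb (Fin n) d) : Prop :=
  ∃ A : Finset (Fin n), IsBipartition A ∧ IsSeparable A φ

/-- The squared overlaps of `ψ` with the pure states separable with respect to `A | Aᶜ`. -/
def cutOverlaps {n d : ℕ} (A : Finset (Fin n)) (ψ : Hilb (Fin n) d) : Set ℝ :=
  {x | ∃ φ : Hilb (Fin n) d, IsSeparable A φ ∧ x = ‖inner ℂ φ ψ‖ ^ 2}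

/-- The squared overlaps of `ψ` with the pure biseparable states. -/
def biseparableOverlaps {n d : ℕ} (ψ : Hilb (Fin n) d) : Set ℝ :=
  {x | ∃ φ : Hilb (Fin n) d, IsBiseparable φ ∧ x = ‖inner ℂ φ ψ‖ ^ 2}

/-- The bipartite entanglement of `ψ` with respect to `A | Aᶜ`: one minus the maximal squared
overlap with the pure states separable with respect to `A | Aᶜ`. -/
def bipartiteEntanglement {n d : ℕ} (A : Finset (Fin n)) (ψ : Hilb (Fin n) d) : ℝ :=
  1 - sSup (cutOverlaps A ψ)

/-- The multipartite entanglement of `ψ`: the minimum, over all bipartitions, of the bipartite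
entanglement. -/
def multipartiteEntanglement {n d : ℕ} (ψ : Hilb (Fin n) d) : ℝ :=
  ⨅ A : {A : Finset (Fin n) // IsBipartition A}, bipartiteEntanglement A.1 ψ

/-- The string on all the qudits that is `s` on `A` and `t` outside `A`. -/
def glue {n d : ℕ} (A : Finset (Fin n)) (s : Str {i // i ∈ A} d) (t : Str {i // i ∉ A} d) :
    Str (Fin n) d :=
  fun i => if h : i ∈ A then s ⟨i, h⟩ else t ⟨i, h⟩

/-- The coefficients of `ψ`, as a matrix with rows indexed by the strings on `A` and columns
indexed by the strings outside `A`. -/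
def coeffMatrix {n d : ℕ} (A : Finset (Fin n)) (ψ : Hilb (Fin n) d) :
    Matrix (Str {i // i ∈ A} d) (Str {i // i ∉ A} d) ℂ :=
  Matrix.of fun s t => ψ (glue A s t)

/-- The largest Schmidt coefficient of `ψ` with respect to `A | Aᶜ`. The Schmidt coefficients are
the singular values of the coefficient matrix, which Mathlib lists in decreasing order. -/
def maxSchmidtCoeff {n d : ℕ} (A : Finset (Fin n)) (ψ : Hilb (Fin n) d) : ℝ :=
  (Matrix.toEuclideanLin (coeffMatrix A ψ)).singularValues 0

/-- The reduced density matrix on the qudits in `A`: the partial trace of `|ψ⟩⟨ψ|` over the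
qudits outside `A`. -/
def reducedState {n d : ℕ} (A : Finset (Fin n)) (ψ : Hilb (Fin n) d) :
    Matrix (Str {i // i ∈ A} d) (Str {i // i ∈ A} d) ℂ :=
  Matrix.of fun s s' => ∑ t : Str {i // i ∉ A} d,
    ψ (glue A s t) * (starRingEnd ℂ) (ψ (glue A s' t))

/-- The infinity norm of a square matrix: the largest absolute row sum. -/
def infNorm {ι : Type} [Fintype ι] (M : Matrix ι ι ℂ) : ℝ :=
  ⨆ i, ∑ j, ‖M i j‖

/-- The factor of the closed formula that belongs to a prime `p`, where `ℓ` and `k` are the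
exponents of `p` in `d` and in `gcd(m, d)`; the formula is used for `2 ≤ n` and `k ≤ ℓ`. -/
def primeFactorTerm (n p ℓ k : ℕ) : ℝ :=
  1 - (1 - (if k = ℓ then 1 else 0)) * (1 - 1 / (p : ℝ)) ^ (n - 1) *
    ∑ j ∈ Finset.range (ℓ - k), ((p : ℝ) ^ j)⁻¹ * (Nat.choose (n + j - 2) j : ℝ)

/-- The product of these factors over the prime factors of `d`. -/
def alphaFormula (n d m : ℕ) : ℝ :=
  ∏ p ∈ d.primeFactors, primeFactorTerm n p (d.factorization p) ((Nat.gcd m d).factorization p)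

end QuditHypergraph

end

/-! Everything reduces to one exponential sum. Summing `ω ^ (c q₁⋯q_k)` over one coordinate gives
`d` or `0`, so for `k ≥ 1` the full sum is `d` times the number of `(k-1)`-tuples with `d ∣ c
q₁⋯q_{k-1}` (`sum_omega_zpow_prod`). In particular it is nonnegative.

Upper bound: by Cauchy–Schwarz, the squared overlap with `a ⊗ b` is at most `⟨a|ρ^A|a⟩`, hence at
most `‖ρ^A‖_∞` by the Schur test. The entries of `ρ^A` are such sums, so they equal their absolute
values. A row sum depends on `s` only through phases in `∏ s`, and is maximal when that product is
zero. There it equals `d⁻ⁿ ∑_q ω ^ (-m ∏ q)`, which no longer sees the cut.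

Attainment: if `B` is one qudit, contracting the state with `|+⟩` on `B` leaves a constant vector on
the strings whose product is annihilated by `m`. Their number is the same count. The same `|+⟩` is
an eigenvector of `M†M` for the coefficient matrix `M`, which settles the Schmidt coefficient.

Closed formula: the count is multiplicative in `d` by the Chinese remainder theorem; prime powers
follow by conditioning on one factor (`dvdCount_prime_pow`). -/

noncomputable section

namespace QuditHypergraph

/-! ### Counting tuples with divisible product: prime powers -/

/-- The number of `N`-tuples `q` with entries in `{0, …, d-1}` such that `e ∣ c * q₁ ⋯ q_N`. -/
def dvdCount (e d N : ℕ) (c : ℤ) : ℕ :=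
  (Finset.univ.filter fun q : Fin N → Fin d => (e : ℤ) ∣ c * ∏ i, ((q i : ℕ) : ℤ)).card

theorem dvdCount_succ (e d N : ℕ) (c : ℤ) :
    dvdCount e d (N + 1) c = ∑ x : Fin d, dvdCount e d N (c * (x : ℕ)) := by
  simp only [dvdCount, Finset.card_filter]
  rw [← (Fin.consEquiv fun _ : Fin (N + 1) => Fin d).sum_comp, Fintype.sum_prod_type]
  simp [Fin.consEquiv, Fin.prod_univ_succ, mul_assoc]

/-- The modulus `e` is kept apart from the range `d` of the entries, so that common factors of `e`
and `c` can be cancelled without changing the set of tuples. -/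
theorem dvdCount_congr {e e' d N : ℕ} {c c' : ℤ}
    (h : ∀ y : ℤ, (e : ℤ) ∣ c * y ↔ (e' : ℤ) ∣ c' * y) : dvdCount e d N c = dvdCount e' d N c' := by
  simp only [dvdCount, h]

theorem dvdCount_neg (e d N : ℕ) (c : ℤ) : dvdCount e d N (-c) = dvdCount e d N c :=
  dvdCount_congr fun y => by simp

theorem sum_range_mul_eq (f : ℕ → ℝ) (p M : ℕ) :
    ∑ x ∈ Finset.range (M * p), f x = ∑ y ∈ Finset.range M, ∑ z ∈ Finset.range p, f (p * y + z) := by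
  induction M with
  | zero => simp
  | succ M ih =>
    rw [Nat.succ_mul, Finset.sum_range_add, Finset.sum_range_succ, ih]
    simp [mul_comm]

/-- The probability that `p ^ r` divides the product of `N` independent uniform `p`-adic
integers. -/
def powDvdProb (p N r : ℕ) : ℝ :=
  1 - (1 - 1 / (p : ℝ)) ^ N * ∑ j ∈ Finset.range r, ((p : ℝ) ^ j)⁻¹ * (Nat.choose (N + j - 1) j : ℝ)

theorem powDvdProb_zero_right (p N : ℕ) : powDvdProb p N 0 = 1 := by simp [powDvdProb]

/-- Truncated subtraction gives the right convention at `N = 0`: the binomial is `1` for `j = 0` and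
`0` for `j > 0`. -/
theorem powDvdProb_zero_left (p r : ℕ) : powDvdProb p 0 (r + 1) = 0 := by
  simp [powDvdProb, Finset.sum_range_succ']

/-- Conditioning on one factor: with probability `1 - 1/p` it is a unit and can be dropped;
otherwise dividing it by `p` leaves a uniform factor and lowers `r` by one. Algebraically this is
Pascal's rule. -/
theorem powDvdProb_succ_succ {p : ℕ} (hp : p ≠ 0) (N r : ℕ) :
    p * powDvdProb p (N + 1) (r + 1) =
      (p - 1) * powDvdProb p N (r + 1) + powDvdProb p (N + 1) r := by
  have hp' : (p : ℝ) ≠ 0 := by exact_mod_cast hp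
  have key : ∑ j ∈ Finset.range (r + 1),
        ((p : ℝ) ^ j)⁻¹ * (Nat.choose (N + 1 + j - 1) j : ℝ) =
      ∑ j ∈ Finset.range (r + 1), ((p : ℝ) ^ j)⁻¹ * (Nat.choose (N + j - 1) j : ℝ) +
      (p : ℝ)⁻¹ * ∑ j ∈ Finset.range r,
        ((p : ℝ) ^ j)⁻¹ * (Nat.choose (N + 1 + j - 1) j : ℝ) := by
    rw [Finset.sum_range_succ', Finset.sum_range_succ' _ r, Finset.mul_sum,
      add_right_comm _ _ (∑ i ∈ Finset.range r, _), ← Finset.sum_add_distrib]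
    congr 1
    · refine Finset.sum_congr rfl fun j _ => ?_
      have h1 : N + 1 + (j + 1) - 1 = (N + j) + 1 := by omega
      have h2 : N + (j + 1) - 1 = N + j := by omega
      have h3 : N + 1 + j - 1 = N + j := by omega
      rw [h1, h2, h3, Nat.choose_succ_succ, pow_succ]
      push_cast
      field_simp
      ring
    · simp
  simp only [powDvdProb]
  rw [key, pow_succ]
  field_simp
  ring

theorem dvdCount_zero (e d : ℕ) (c : ℤ) : dvdCount e d 0 c = if (e : ℤ) ∣ c then 1 else 0 := by
  simp only [dvdCount, Finset.card_filter]
  simp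

theorem dvdCount_one_left (d N : ℕ) (c : ℤ) : dvdCount 1 d N c = d ^ N := by
  simp [dvdCount]

theorem dvdCount_prime_pow {p : ℕ} (hp : p.Prime) (l N : ℕ) :
    ∀ r ≤ l, (dvdCount (p ^ r) (p ^ l) N 1 : ℝ) = (p ^ l : ℝ) ^ N * powDvdProb p N r := by
  have hp0 : (p : ℤ) ≠ 0 := by exact_mod_cast hp.ne_zero
  induction N with
  | zero =>
    intro r hr
    cases r with
    | zero => simp [dvdCount_zero, powDvdProb_zero_right]
    | succ r =>
      have h : ¬ ((p ^ (r + 1) : ℕ) : ℤ) ∣ 1 := by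
        intro h
        have := Nat.dvd_one.1 (by exact_mod_cast h)
        have h2 := hp.one_lt
        exact (Nat.one_lt_pow (Nat.succ_ne_zero r) h2).ne' this
      rw [dvdCount_zero, if_neg h, powDvdProb_zero_left]
      simp
  | succ N ih =>
    -- The range `p ^ l'` of the new factor is left free, because dividing that factor by `p`
    -- shrinks its range while the other `N` entries still range below `p ^ l`.
    have main : ∀ r ≤ l, ∀ l', r ≤ l' →
        ∑ x ∈ Finset.range (p ^ l'), (dvdCount (p ^ r) (p ^ l) N (x : ℕ) : ℝ) =
          (p : ℝ) ^ l' * (p ^ l : ℝ) ^ N * powDvdProb p (N + 1) r := by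
      intro r
      induction r with
      | zero =>
        intro _ l' _
        simp [dvdCount_one_left, powDvdProb_zero_right]
      | succ r ihr =>
        intro hr l' hl'
        obtain ⟨k, rfl⟩ : ∃ k, l' = k + 1 := ⟨l' - 1, by omega⟩
        rw [pow_succ, sum_range_mul_eq]
        obtain ⟨s, hs⟩ : ∃ s, p = s + 1 := ⟨p - 1, by have := hp.one_lt; omega⟩
        have hmul : ∀ y : ℕ, dvdCount (p ^ (r + 1)) (p ^ l) N ((p * y : ℕ) : ℤ) =
            dvdCount (p ^ r) (p ^ l) N (y : ℤ) := fun y => dvdCount_congr fun w => by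
          push_cast
          rw [pow_succ', mul_assoc]
          exact mul_dvd_mul_iff_left hp0
        have hunit : ∀ y z : ℕ, z < s →
            dvdCount (p ^ (r + 1)) (p ^ l) N ((p * y + (z + 1) : ℕ) : ℤ) =
            dvdCount (p ^ (r + 1)) (p ^ l) N 1 := fun y z hz => dvdCount_congr fun w => by
          have hc : IsCoprime ((p ^ (r + 1) : ℕ) : ℤ) ((p * y + (z + 1) : ℕ) : ℤ) := by
            rw [Nat.isCoprime_iff_coprime]
            refine Nat.Coprime.pow_left _ ((Nat.Prime.coprime_iff_not_dvd hp).2 fun h => ?_)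
            have h' := (Nat.dvd_add_right (dvd_mul_right p y)).1 h
            have := Nat.le_of_dvd (Nat.succ_pos z) h'
            omega
          rw [one_mul]
          exact ⟨fun h => hc.dvd_of_dvd_mul_left h, fun h => h.mul_left _⟩
        have hinner : ∀ y : ℕ, ∑ z ∈ Finset.range p,
            (dvdCount (p ^ (r + 1)) (p ^ l) N ((p * y + z : ℕ) : ℤ) : ℝ) =
            (p - 1) * ((p ^ l : ℝ) ^ N * powDvdProb p N (r + 1)) +
              dvdCount (p ^ r) (p ^ l) N (y : ℤ) := fun y => by
          have hr' : Finset.range p = Finset.range (s + 1) := by rw [hs]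
          rw [hr', Finset.sum_range_succ', add_zero (p * y), hmul,
            Finset.sum_congr rfl fun z hz => by
              rw [hunit y z (Finset.mem_range.1 hz), ih _ hr],
            Finset.sum_const, Finset.card_range, nsmul_eq_mul]
          have : (s : ℝ) = p - 1 := by rw [hs]; push_cast; ring
          rw [this]
        rw [Finset.sum_congr rfl fun y _ => hinner y, Finset.sum_add_distrib,
          ihr (by omega) k (by omega), Finset.sum_const, Finset.card_range, nsmul_eq_mul]
        have := powDvdProb_succ_succ hp.ne_zero N r
        push_cast
        linear_combination (-(p : ℝ) ^ k * (p ^ l : ℝ) ^ N) * this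
    intro r hr
    rw [dvdCount_succ, Nat.cast_sum,
      Fin.sum_univ_eq_sum_range (fun x => (dvdCount (p ^ r) (p ^ l) N (1 * (x : ℤ)) : ℝ))]
    simp only [one_mul]
    rw [main r hr l hr, pow_succ]
    ring

/-! ### Reduction to prime powers and the closed formula -/

/-- The bijection `Fin d ≃ ZMod d` given by reduction modulo `d`. -/
def finEquivZMod (d : ℕ) [NeZero d] : Fin d ≃ ZMod d where
  toFun x := ((x : ℕ) : ZMod d)
  invFun y := ⟨y.val, y.val_lt⟩
  left_inv x := by ext; simp [ZMod.val_cast_of_lt x.2]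
  right_inv y := by simp

theorem dvdCount_eq_card_zmod (d N : ℕ) [NeZero d] (c : ℤ) :
    dvdCount d d N c =
      (Finset.univ.filter fun q : Fin N → ZMod d => (c : ZMod d) * ∏ i, q i = 0).card := by
  simp only [dvdCount, Finset.card_filter]
  rw [← (Equiv.piCongrRight fun _ : Fin N => finEquivZMod d).sum_comp]
  refine Finset.sum_congr rfl fun q _ => ?_
  refine if_congr ?_ rfl rfl
  rw [← ZMod.intCast_zmod_eq_zero_iff_dvd]
  simp [finEquivZMod]

theorem dvdCount_mul_of_coprime {a b : ℕ} (ha : a ≠ 0) (hb : b ≠ 0) (hab : a.Coprime b) (N : ℕ)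
    (c : ℤ) : dvdCount (a * b) (a * b) N c = dvdCount a a N c * dvdCount b b N c := by
  have := NeZero.mk ha
  have := NeZero.mk hb
  have := NeZero.mk (mul_ne_zero ha hb)
  rw [dvdCount_eq_card_zmod, dvdCount_eq_card_zmod, dvdCount_eq_card_zmod]
  have e := ZMod.chineseRemainder hab
  simp only [Finset.card_filter]
  rw [← ((Equiv.piCongrRight fun _ : Fin N => e.toEquiv).trans
    (Equiv.arrowProdEquivProdArrow (Fin N) (fun _ => ZMod a) (fun _ => ZMod b))).symm.sum_comp,
    Fintype.sum_prod_type, Finset.sum_mul_sum]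
  refine Finset.sum_congr rfl fun x _ => Finset.sum_congr rfl fun y _ => ?_
  have hx : e (∏ i, e.symm (x i, y i)) = (∏ i, x i, ∏ i, y i) := by
    rw [map_prod]
    simp [Prod.ext_iff, Prod.fst_prod, Prod.snd_prod]
  rw [ite_zero_mul_ite_zero, mul_one]
  refine if_congr ?_ rfl rfl
  rw [← e.map_eq_zero_iff, map_mul, map_intCast]
  change (c : ZMod a × ZMod b) * e (∏ i, e.symm (x i, y i)) = 0 ↔ _
  simp [hx, Prod.ext_iff, -map_prod]

/-- The Kronecker delta is redundant: for `k = l` the sum is already empty. -/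
theorem primeFactorTerm_eq (p N l k : ℕ) :
    primeFactorTerm (N + 1) p l k = powDvdProb p N (l - k) := by
  unfold primeFactorTerm powDvdProb
  have h : ∀ j, N + 1 + j - 2 = N + j - 1 := fun j => by omega
  by_cases hkl : k = l
  · simp [hkl]
  · simp [hkl, h]

theorem dvdCount_prime_pow_self {p : ℕ} (hp : p.Prime) (l N m : ℕ) :
    (dvdCount (p ^ l) (p ^ l) N m : ℝ) =
      (p ^ l : ℝ) ^ N * primeFactorTerm (N + 1) p l ((m.gcd (p ^ l)).factorization p) := by
  obtain ⟨k, hk, hg⟩ := (Nat.dvd_prime_pow hp).1 (Nat.gcd_dvd_right m (p ^ l))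
  rw [hg, hp.factorization_pow, Finsupp.single_eq_same, primeFactorTerm_eq,
    ← dvdCount_prime_pow hp l N _ (Nat.sub_le l k)]
  congr 1
  refine dvdCount_congr fun y => ?_
  have hpk : p ^ k ≠ 0 := pow_ne_zero _ hp.ne_zero
  obtain ⟨m', hm'⟩ : p ^ k ∣ m := hg ▸ Nat.gcd_dvd_left m (p ^ l)
  have hl : p ^ l = p ^ k * p ^ (l - k) := by rw [← pow_add]; congr 1; omega
  have hc : Nat.Coprime (p ^ (l - k)) m' := by
    have : p ^ k * Nat.gcd m' (p ^ (l - k)) = p ^ k * 1 := by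
      rw [← Nat.gcd_mul_left, ← hm', ← hl, hg, mul_one]
    rw [Nat.coprime_comm]
    exact Nat.eq_of_mul_eq_mul_left (Nat.pos_of_ne_zero hpk) this
  rw [hl, hm']
  push_cast
  rw [mul_assoc, mul_dvd_mul_iff_left (by exact_mod_cast hpk), one_mul]
  have hc' : IsCoprime ((p : ℤ) ^ (l - k)) m' := by
    exact_mod_cast Nat.isCoprime_iff_coprime.2 hc
  exact ⟨fun h => hc'.dvd_of_dvd_mul_left h, fun h => h.mul_left _⟩

theorem factorization_gcd_ordProj {m d p : ℕ} (hd : d ≠ 0) (hp : p.Prime) :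
    (m.gcd (p ^ d.factorization p)).factorization p = (m.gcd d).factorization p := by
  rcases eq_or_ne m 0 with rfl | hm
  · simp [hp.factorization_pow]
  · rw [Nat.factorization_gcd hm (pow_ne_zero _ hp.ne_zero), Nat.factorization_gcd hm hd]
    simp [hp.factorization_pow]

theorem dvdCount_eq_alphaFormula {d : ℕ} (hd : d ≠ 0) (N m : ℕ) :
    (dvdCount d d N m : ℝ) = (d : ℝ) ^ N * alphaFormula (N + 1) d m := by
  -- The value at `0` is a harmless convention: multiplicativity is required of all coprime pairs,
  -- and `0` is coprime only to `1`.
  have key : ∀ {d : ℕ}, d ≠ 0 →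
      (if d = 0 then (1 : ℝ) else dvdCount d d N m) = d.factorization.prod fun p k =>
        (if p ^ k = 0 then (1 : ℝ) else dvdCount (p ^ k) (p ^ k) N m) := by
    intro d hd
    refine Nat.multiplicative_factorization
      (fun d => if d = 0 then (1 : ℝ) else dvdCount d d N m) ?_ ?_ hd
    · intro a b hab
      rcases eq_or_ne a 0 with rfl | ha
      · obtain rfl : b = 1 := by simpa using hab
        simp [dvdCount_one_left]
      rcases eq_or_ne b 0 with rfl | hb
      · obtain rfl : a = 1 := by simpa using hab
        simp [dvdCount_one_left]
      simp [ha, hb, dvdCount_mul_of_coprime ha hb hab]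
    · simp [dvdCount_one_left]
  have hk := key hd
  rw [if_neg hd] at hk
  rw [hk, alphaFormula, Finsupp.prod, Nat.support_factorization]
  have hdp : (d : ℝ) = ∏ p ∈ d.primeFactors, (p : ℝ) ^ d.factorization p := by
    conv_lhs => rw [← Nat.prod_factorization_pow_eq_self hd]
    rw [Finsupp.prod, Nat.support_factorization]
    push_cast
    rfl
  conv_rhs => rw [hdp, ← Finset.prod_pow, ← Finset.prod_mul_distrib]
  refine Finset.prod_congr rfl fun p hp => ?_
  have hp' := Nat.prime_of_mem_primeFactors hp
  rw [if_neg (pow_ne_zero _ hp'.ne_zero), dvdCount_prime_pow_self hp',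
    factorization_gcd_ordProj hd hp']

/-! ### Exponential sums -/

section RootsOfUnity

variable {d : ℕ}

theorem omega_isPrimitiveRoot (hd : d ≠ 0) : IsPrimitiveRoot (omega d) d :=
  Complex.isPrimitiveRoot_exp d hd

theorem omega_ne_zero (d : ℕ) : omega d ≠ 0 := Complex.exp_ne_zero _

theorem norm_omega (hd : d ≠ 0) : ‖omega d‖ = 1 := (omega_isPrimitiveRoot hd).norm'_eq_one hd

theorem conj_omega_zpow (hd : d ≠ 0) (x : ℤ) :
    (starRingEnd ℂ) (omega d ^ x) = omega d ^ (-x) := by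
  rw [map_zpow₀, ← Complex.inv_eq_conj (norm_omega hd), inv_zpow, zpow_neg]

theorem sum_omega_zpow (hd : d ≠ 0) (c : ℤ) :
    ∑ x : Fin d, omega d ^ (c * ((x : ℕ) : ℤ)) = if (d : ℤ) ∣ c then (d : ℂ) else 0 := by
  have h := omega_isPrimitiveRoot hd
  simp only [zpow_mul, zpow_natCast]
  rw [Fin.sum_univ_eq_sum_range fun x => (omega d ^ c) ^ x]
  split_ifs with hc
  · simp [(h.zpow_eq_one_iff_dvd c).2 hc]
  · have h1 : omega d ^ c ≠ 1 := fun h' => hc ((h.zpow_eq_one_iff_dvd c).1 h')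
    rw [geom_sum_eq h1, ← zpow_natCast, zpow_comm, zpow_natCast, h.pow_eq_one]
    simp

theorem sum_omega_zpow_prod_fin (hd : d ≠ 0) (N : ℕ) (c : ℤ) :
    ∑ q : Fin (N + 1) → Fin d, omega d ^ (c * ∏ i, ((q i : ℕ) : ℤ)) =
      ((d * dvdCount d d N c : ℕ) : ℂ) := by
  rw [← (Fin.consEquiv fun _ : Fin (N + 1) => Fin d).sum_comp, Fintype.sum_prod_type_right]
  simp only [Fin.consEquiv, Equiv.coe_fn_mk, Fin.prod_univ_succ, Fin.cons_zero, Fin.cons_succ]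
  have : ∀ q : Fin N → Fin d, ∑ x : Fin d,
      omega d ^ (c * (((x : ℕ) : ℤ) * ∏ i, ((q i : ℕ) : ℤ))) =
        if (d : ℤ) ∣ c * ∏ i, ((q i : ℕ) : ℤ) then (d : ℂ) else 0 := fun q => by
    rw [← sum_omega_zpow hd]
    exact Finset.sum_congr rfl fun x _ => by congr 1; ring
  rw [Finset.sum_congr rfl fun q _ => this q, ← Finset.sum_filter, Finset.sum_const, dvdCount]
  push_cast
  rw [nsmul_eq_mul, mul_comm]

theorem sum_omega_zpow_prod {ι : Type} [Fintype ι] [DecidableEq ι] (hd : d ≠ 0) {N : ℕ}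
    (hN : Fintype.card ι = N + 1) (c : ℤ) :
    ∑ q : Str ι d, omega d ^ (c * ∏ i, ((q i : ℕ) : ℤ)) = ((d * dvdCount d d N c : ℕ) : ℂ) := by
  rw [← sum_omega_zpow_prod_fin hd]
  have e := Fintype.equivFinOfCardEq hN
  rw [← (Equiv.arrowCongr e (Equiv.refl (Fin d))).symm.sum_comp]
  refine Finset.sum_congr rfl fun q _ => ?_
  congr 2
  rw [← e.prod_comp]
  rfl

/-- What matters is nonnegativity for every `c`. It needs at least one variable to sum over, hence
non-empty parts of the cut. -/
theorem exists_sum_omega_zpow_prod_eq {ι : Type} [Fintype ι] [DecidableEq ι] [Nonempty ι]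
    (hd : d ≠ 0) (c : ℤ) :
    ∃ K : ℕ, ∑ q : Str ι d, omega d ^ (c * ∏ i, ((q i : ℕ) : ℤ)) = K :=
  ⟨_, sum_omega_zpow_prod hd (Nat.succ_pred_eq_of_pos Fintype.card_pos).symm c⟩

end RootsOfUnity

/-! ### Bounds for an arbitrary state across a cut -/

section Cut

variable {n d : ℕ} (A : Finset (Fin n))

/-- Splitting a string into its parts on `A` and outside `A`. -/
def splitEquiv (d : ℕ) : Str (Fin n) d ≃ Str {i // i ∈ A} d × Str {i // i ∉ A} d :=
  Equiv.piEquivPiSubtypeProd (fun i => i ∈ A) fun _ => Fin d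

theorem sum_str_eq_sum_glue {M : Type*} [AddCommMonoid M] (f : Str (Fin n) d → M) :
    ∑ q, f q = ∑ s, ∑ t, f (glue A s t) := by
  rw [← (splitEquiv A d).symm.sum_comp, Fintype.sum_prod_type]
  rfl

theorem glue_restrict_left (s : Str {i // i ∈ A} d) (t : Str {i // i ∉ A} d) :
    (fun i : {i // i ∈ A} => glue A s t i) = s := by
  ext i
  simp [glue, i.2]

theorem glue_restrict_right (s : Str {i // i ∈ A} d) (t : Str {i // i ∉ A} d) :
    (fun i : {i // i ∉ A} => glue A s t i) = t := by
  ext i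
  simp [glue, i.2]

theorem prod_glue (s : Str {i // i ∈ A} d) (t : Str {i // i ∉ A} d) :
    ∏ i, ((glue A s t i : ℕ) : ℤ) = (∏ i, ((s i : ℕ) : ℤ)) * ∏ i, ((t i : ℕ) : ℤ) := by
  rw [← Fintype.prod_subtype_mul_prod_subtype (fun i => i ∈ A)]
  congr 1
  · exact Finset.prod_congr (by ext; simp) fun i _ => by simp [glue, i.2]
  · exact Finset.prod_congr (by ext; simp) fun i _ => by simp [glue, i.2]

theorem inner_tensor (a : Hilb {i // i ∈ A} d) (b : Hilb {i // i ∉ A} d) (ψ : Hilb (Fin n) d) :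
    inner ℂ (tensor A a b) ψ =
      ∑ s, ∑ t, (starRingEnd ℂ) (a s) * (starRingEnd ℂ) (b t) * ψ (glue A s t) := by
  rw [PiLp.inner_apply, sum_str_eq_sum_glue A]
  refine Finset.sum_congr rfl fun s _ => Finset.sum_congr rfl fun t _ => ?_
  simp [tensor, glue_restrict_left, glue_restrict_right, mul_comm]

/-- The Schur test: a vector's quadratic form is at most the largest absolute row sum. -/
theorem norm_quadratic_le_infNorm {ι : Type} [Fintype ι] (M : Matrix ι ι ℂ)
    (hM : ∀ i j, ‖M i j‖ = ‖M j i‖) (a : EuclideanSpace ℂ ι) :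
    ‖∑ i, ∑ j, (starRingEnd ℂ) (a i) * a j * M i j‖ ≤ infNorm M * ‖a‖ ^ 2 := by
  have hrow : ∀ i, ∑ j, ‖M i j‖ ≤ infNorm M := fun i =>
    le_ciSup (f := fun i => ∑ j, ‖M i j‖) (Set.finite_range _).bddAbove i
  have hhalf : ∑ i, ∑ j, ‖a i‖ ^ 2 * ‖M i j‖ ≤ infNorm M * ‖a‖ ^ 2 := by
    rw [EuclideanSpace.norm_sq_eq, Finset.mul_sum]
    refine Finset.sum_le_sum fun i _ => ?_
    rw [← Finset.mul_sum, mul_comm]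
    exact mul_le_mul_of_nonneg_right (hrow i) (by positivity)
  have hhalf' : ∑ i, ∑ j, ‖a j‖ ^ 2 * ‖M i j‖ ≤ infNorm M * ‖a‖ ^ 2 := by
    rw [Finset.sum_comm]
    refine le_trans (le_of_eq ?_) hhalf
    exact Finset.sum_congr rfl fun i _ => Finset.sum_congr rfl fun j _ => by rw [hM]
  calc ‖∑ i, ∑ j, (starRingEnd ℂ) (a i) * a j * M i j‖
      ≤ ∑ i, ∑ j, ‖(starRingEnd ℂ) (a i) * a j * M i j‖ :=
        (norm_sum_le _ _).trans (Finset.sum_le_sum fun i _ => norm_sum_le _ _)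
    _ ≤ ∑ i, ∑ j, (‖a i‖ ^ 2 * ‖M i j‖ + ‖a j‖ ^ 2 * ‖M i j‖) / 2 := by
        refine Finset.sum_le_sum fun i _ => Finset.sum_le_sum fun j _ => ?_
        rw [norm_mul, norm_mul, RCLike.norm_conj, ← add_mul]
        -- AM-GM: `‖a i‖ ‖a j‖ ≤ (‖a i‖² + ‖a j‖²) / 2`.
        nlinarith [mul_nonneg (sq_nonneg (‖a i‖ - ‖a j‖)) (norm_nonneg (M i j))]
    _ = (∑ i, ∑ j, ‖a i‖ ^ 2 * ‖M i j‖ + ∑ i, ∑ j, ‖a j‖ ^ 2 * ‖M i j‖) / 2 := by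
        simp only [← Finset.sum_div, Finset.sum_add_distrib]
    _ ≤ infNorm M * ‖a‖ ^ 2 := by linarith

theorem norm_reducedState_comm (ψ : Hilb (Fin n) d) (s s' : Str {i // i ∈ A} d) :
    ‖reducedState A ψ s s'‖ = ‖reducedState A ψ s' s‖ := by
  rw [← RCLike.norm_conj]
  simp [reducedState, mul_comm]

/-- The left side is `⟨a|ρ^A|a⟩`, to which the Schur test applies. -/
theorem sum_norm_sq_le_infNorm (ψ : Hilb (Fin n) d) (a : Hilb {i // i ∈ A} d) :
    ∑ t, ‖∑ s, (starRingEnd ℂ) (a s) * ψ (glue A s t)‖ ^ 2 ≤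
      infNorm (reducedState A ψ) * ‖a‖ ^ 2 := by
  refine le_trans (le_of_eq ?_)
    (norm_quadratic_le_infNorm (reducedState A ψ) (norm_reducedState_comm A ψ) a)
  have : ((∑ t, ‖∑ s, (starRingEnd ℂ) (a s) * ψ (glue A s t)‖ ^ 2 : ℝ) : ℂ) =
      ∑ s, ∑ s', (starRingEnd ℂ) (a s) * a s' * reducedState A ψ s s' := by
    push_cast
    simp only [← Complex.mul_conj', map_sum, map_mul, Complex.conj_conj, Finset.sum_mul_sum,
      reducedState, Matrix.of_apply]
    simp only [Finset.mul_sum]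
    rw [Finset.sum_comm]
    refine Finset.sum_congr rfl fun s _ => ?_
    rw [Finset.sum_comm]
    exact Finset.sum_congr rfl fun s' _ => Finset.sum_congr rfl fun t _ => by ring
  rw [← this, Complex.norm_real, Real.norm_of_nonneg (by positivity)]

/-- The bilinear form of the coefficients is bounded by the infinity norm of the reduced state. -/
theorem norm_bilinear_sq_le (ψ : Hilb (Fin n) d) (a : Hilb {i // i ∈ A} d)
    (b : Hilb {i // i ∉ A} d) :
    ‖∑ s, ∑ t, (starRingEnd ℂ) (a s) * (b t) * ψ (glue A s t)‖ ^ 2 ≤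
      infNorm (reducedState A ψ) * ‖a‖ ^ 2 * ‖b‖ ^ 2 := by
  have h : ∑ s, ∑ t, (starRingEnd ℂ) (a s) * (b t) * ψ (glue A s t) =
      ∑ t, (∑ s, (starRingEnd ℂ) (a s) * ψ (glue A s t)) * b t := by
    rw [Finset.sum_comm]
    refine Finset.sum_congr rfl fun t _ => ?_
    rw [Finset.sum_mul]
    exact Finset.sum_congr rfl fun s _ => by ring
  rw [h]
  calc _ ≤ (∑ t, ‖∑ s, (starRingEnd ℂ) (a s) * ψ (glue A s t)‖ * ‖b t‖) ^ 2 := by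
        gcongr
        refine (norm_sum_le _ _).trans (Finset.sum_le_sum fun t _ => (norm_mul_le _ _))
    _ ≤ (∑ t, ‖∑ s, (starRingEnd ℂ) (a s) * ψ (glue A s t)‖ ^ 2) * ∑ t, ‖b t‖ ^ 2 :=
        Finset.sum_mul_sq_le_sq_mul_sq _ _ _
    _ ≤ _ := by
        rw [← EuclideanSpace.norm_sq_eq]
        gcongr
        exact sum_norm_sq_le_infNorm A ψ a

theorem overlap_le_infNorm (ψ : Hilb (Fin n) d) {φ : Hilb (Fin n) d} (hφ : IsSeparable A φ) :
    ‖inner ℂ φ ψ‖ ^ 2 ≤ infNorm (reducedState A ψ) := by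
  obtain ⟨a, b, ha, hb, rfl⟩ := hφ
  -- The bilinear form is not conjugated in its second argument, whereas the overlap is.
  have h := norm_bilinear_sq_le A ψ a (WithLp.toLp 2 fun t => (starRingEnd ℂ) (b t))
  have hb' : ‖(WithLp.toLp 2 fun t => (starRingEnd ℂ) (b t) : Hilb {i // i ∉ A} d)‖ = 1 := by
    rw [← hb, EuclideanSpace.norm_eq, EuclideanSpace.norm_eq]
    simp
  rw [hb', ha] at h
  rw [inner_tensor]
  simpa using h

theorem toEuclideanLin_coeffMatrix_apply (ψ : Hilb (Fin n) d) (b : Hilb {i // i ∉ A} d)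
    (s : Str {i // i ∈ A} d) :
    Matrix.toEuclideanLin (coeffMatrix A ψ) b s = ∑ t, ψ (glue A s t) * b t := by
  simp [Matrix.toLpLin_apply, Matrix.mulVec, dotProduct, coeffMatrix]

/-- Testing the bilinear bound on `y = M b` itself gives `‖y‖⁴ ≤ ‖ρ^A‖_∞ ‖y‖² ‖b‖²`; then `‖y‖²`
cancels. -/
theorem norm_toEuclideanLin_coeffMatrix_sq_le (ψ : Hilb (Fin n) d) (b : Hilb {i // i ∉ A} d) :
    ‖Matrix.toEuclideanLin (coeffMatrix A ψ) b‖ ^ 2 ≤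
      infNorm (reducedState A ψ) * ‖b‖ ^ 2 := by
  set y := Matrix.toEuclideanLin (coeffMatrix A ψ) b with hy
  have h := norm_bilinear_sq_le A ψ y b
  have hyy : ∑ s, ∑ t, (starRingEnd ℂ) (y s) * (b t) * ψ (glue A s t) = ((‖y‖ ^ 2 : ℝ) : ℂ) := by
    rw [EuclideanSpace.norm_sq_eq]
    push_cast
    refine Finset.sum_congr rfl fun s _ => ?_
    rw [← Complex.conj_mul', hy, toEuclideanLin_coeffMatrix_apply, Finset.mul_sum]
    exact Finset.sum_congr rfl fun t _ => by ring
  rw [hyy, Complex.norm_real, Real.norm_of_nonneg (by positivity)] at h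
  have hI : 0 ≤ infNorm (reducedState A ψ) :=
    Real.iSup_nonneg fun i => Finset.sum_nonneg fun j _ => norm_nonneg _
  rcases eq_or_ne y 0 with h0 | h0
  · rw [h0]
    simp only [norm_zero, ne_eq, OfNat.ofNat_ne_zero, not_false_eq_true, zero_pow]
    positivity
  · have hpos : 0 < ‖y‖ ^ 2 := by positivity
    refine le_of_mul_le_mul_left ?_ hpos
    linarith

end Cut

/-! ### The largest singular value -/

section SingularValues

variable {E F : Type*} [NormedAddCommGroup E] [InnerProductSpace ℂ E] [FiniteDimensional ℂ E]
  [NormedAddCommGroup F] [InnerProductSpace ℂ F] [FiniteDimensional ℂ F]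

/-- An eigenvector `x` of `T†T` for `σ₀²` satisfies `‖T x‖² = σ₀² ‖x‖²`. On a zero-dimensional space
`σ₀` takes the default value `0`. -/
theorem sq_singularValues_zero_le (T : E →ₗ[ℂ] F) {C : ℝ} (hC : 0 ≤ C)
    (h : ∀ x, ‖T x‖ ^ 2 ≤ C * ‖x‖ ^ 2) : T.singularValues 0 ^ 2 ≤ C := by
  by_cases hE : 0 < Module.finrank ℂ E
  · obtain ⟨x, hx⟩ :=
      (T.hasEigenvalue_adjoint_comp_self_sq_singularValues hE).exists_hasEigenvector
    have hx0 : 0 < ‖x‖ ^ 2 := by have := norm_pos_iff.2 hx.2; positivity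
    have hTx : ((‖T x‖ ^ 2 : ℝ) : ℂ) = ((T.singularValues 0 ^ 2 * ‖x‖ ^ 2 : ℝ) : ℂ) := by
      have h1 := hx.apply_eq_smul
      rw [LinearMap.comp_apply] at h1
      have h2 := LinearMap.adjoint_inner_right T x (T x)
      rw [h1, inner_smul_right, inner_self_eq_norm_sq_to_K, inner_self_eq_norm_sq_to_K] at h2
      push_cast
      exact h2.symm
    have h3 := h x
    rw [Complex.ofReal_injective hTx] at h3
    exact le_of_mul_le_mul_right h3 hx0
  · rw [T.singularValues_of_finrank_le (not_lt.1 hE)]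
    simpa using hC

theorem le_sq_singularValues_zero (T : E →ₗ[ℂ] F) {x : E} (hx : x ≠ 0) {c : ℝ}
    (h : LinearMap.adjoint T (T x) = (c : ℂ) • x) : c ≤ T.singularValues 0 ^ 2 := by
  have he : Module.End.HasEigenvalue (LinearMap.adjoint T ∘ₗ T) (c : ℂ) :=
    Module.End.hasEigenvalue_of_hasEigenvector
      (x := x) ⟨Module.End.mem_eigenspace_iff.2 h, hx⟩
  obtain ⟨i, hi⟩ := T.isSymmetric_adjoint_comp_self.exists_eigenvalues_eq rfl he
  have hi' : T.isSymmetric_adjoint_comp_self.eigenvalues rfl i = c := Complex.ofReal_injective hi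
  rw [← hi', ← T.sq_singularValues_fin rfl i]
  exact pow_le_pow_left₀ (T.singularValues_nonneg _) (T.singularValues_antitone (Nat.zero_le _)) 2

end SingularValues

/-! ### Row sums of the reduced state -/

section ReducedState

variable {n d m : ℕ}

theorem controlledPhase_pow_apply (e : Finset (Fin n)) (ψ : Hilb (Fin n) d) (q : Str (Fin n) d) :
    (controlledPhase n d e ^ m) ψ q = omega d ^ (m * ∏ i ∈ e, (q i : ℕ)) * ψ q := by
  induction m with
  | zero => simp
  | succ m ih =>
    rw [pow_succ', Module.End.mul_apply]
    change omega d ^ (∏ i ∈ e, (q i : ℕ)) * ((controlledPhase n d e ^ m) ψ) q = _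
    rw [ih, add_mul, one_mul, pow_add]
    ring

theorem elementaryState_apply (q : Str (Fin n) d) :
    elementaryState n d m q =
      (((Real.sqrt d)⁻¹ ^ n : ℝ) : ℂ) * omega d ^ ((m : ℤ) * ∏ i, ((q i : ℕ) : ℤ)) := by
  have h : ((m : ℤ) * ∏ i, ((q i : ℕ) : ℤ)) = ((m * ∏ i, (q i : ℕ) : ℕ) : ℤ) := by push_cast; rfl
  rw [elementaryState, controlledPhase_pow_apply, h, zpow_natCast, mul_comm]
  simp [plusState, plusLocal]

theorem inv_sqrt_pow_mul_self (n d : ℕ) :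
    ((Real.sqrt d)⁻¹ ^ n) * ((Real.sqrt d)⁻¹ ^ n) = ((d : ℝ) ^ n)⁻¹ := by
  rw [← mul_pow, ← mul_inv, Real.mul_self_sqrt (Nat.cast_nonneg d), inv_pow]

theorem reducedState_elementaryState_apply (hd : d ≠ 0) (A : Finset (Fin n))
    (s s' : Str {i // i ∈ A} d) :
    reducedState A (elementaryState n d m) s s' = ((((d : ℝ) ^ n)⁻¹ : ℝ) : ℂ) *
      ∑ t : Str {i // i ∉ A} d, omega d ^
        ((m * (∏ i, ((s i : ℕ) : ℤ) - ∏ i, ((s' i : ℕ) : ℤ))) * ∏ i, ((t i : ℕ) : ℤ)) := by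
  rw [reducedState, Matrix.of_apply, Finset.mul_sum]
  refine Finset.sum_congr rfl fun t _ => ?_
  rw [elementaryState_apply, elementaryState_apply, map_mul, Complex.conj_ofReal,
    conj_omega_zpow hd, mul_mul_mul_comm, ← zpow_add₀ (omega_ne_zero d), ← Complex.ofReal_mul,
    inv_sqrt_pow_mul_self, prod_glue, prod_glue]
  congr 2
  ring

theorem norm_reducedState_elementaryState (hd : d ≠ 0) {A : Finset (Fin n)} (hA : IsBipartition A)
    (s s' : Str {i // i ∈ A} d) :
    ((‖reducedState A (elementaryState n d m) s s'‖ : ℝ) : ℂ) =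
      reducedState A (elementaryState n d m) s s' := by
  obtain ⟨i, hi⟩ := hA.2
  have : Nonempty {i // i ∉ A} := ⟨⟨i, Finset.mem_compl.1 hi⟩⟩
  rw [reducedState_elementaryState_apply hd]
  obtain ⟨K, hK⟩ := exists_sum_omega_zpow_prod_eq (ι := {i // i ∉ A}) hd
    (m * (∏ i, ((s i : ℕ) : ℤ) - ∏ i, ((s' i : ℕ) : ℤ)))
  rw [hK, norm_mul, Complex.norm_real, Complex.norm_natCast, Real.norm_of_nonneg (by positivity)]
  push_cast
  rfl

/-- After exchanging the sums, `s` enters only through a unimodular factor in front of a nonnegative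
sum over `s'`; the triangle inequality discards it. -/
theorem sum_norm_reducedState_le (hd : d ≠ 0) {A : Finset (Fin n)} (hA : IsBipartition A)
    (s : Str {i // i ∈ A} d) :
    ∑ s', ‖reducedState A (elementaryState n d m) s s'‖ ≤
      ((d : ℝ) ^ n)⁻¹ * ‖∑ q : Str (Fin n) d, omega d ^ (-(m : ℤ) * ∏ i, ((q i : ℕ) : ℤ))‖ := by
  obtain ⟨i, hi⟩ := hA.1
  have : Nonempty {i // i ∈ A} := ⟨⟨i, hi⟩⟩
  have hsum : ((∑ s', ‖reducedState A (elementaryState n d m) s s'‖ : ℝ) : ℂ) =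
      ((((d : ℝ) ^ n)⁻¹ : ℝ) : ℂ) * ∑ t : Str {i // i ∉ A} d,
        omega d ^ (m * (∏ i, ((s i : ℕ) : ℤ)) * ∏ i, ((t i : ℕ) : ℤ)) *
        ∑ s' : Str {i // i ∈ A} d,
          omega d ^ ((-(m : ℤ) * ∏ i, ((t i : ℕ) : ℤ)) * ∏ i, ((s' i : ℕ) : ℤ)) := by
    rw [Complex.ofReal_sum]
    simp only [norm_reducedState_elementaryState hd hA]
    simp only [reducedState_elementaryState_apply hd, ← Finset.mul_sum]
    rw [Finset.sum_comm]
    congr 1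
    refine Finset.sum_congr rfl fun t _ => ?_
    rw [Finset.mul_sum]
    refine Finset.sum_congr rfl fun s' _ => ?_
    rw [← zpow_add₀ (omega_ne_zero d)]
    congr 1
    ring
  choose K hK using fun c : ℤ => exists_sum_omega_zpow_prod_eq (ι := {i // i ∈ A}) hd c
  have htot : ∑ q : Str (Fin n) d, omega d ^ (-(m : ℤ) * ∏ i, ((q i : ℕ) : ℤ)) =
      ((∑ t : Str {i // i ∉ A} d, K (-(m : ℤ) * ∏ i, ((t i : ℕ) : ℤ)) : ℕ) : ℂ) := by
    rw [sum_str_eq_sum_glue A, Finset.sum_comm, Nat.cast_sum]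
    refine Finset.sum_congr rfl fun t _ => ?_
    rw [← hK]
    refine Finset.sum_congr rfl fun s' _ => ?_
    rw [prod_glue]
    congr 1
    ring
  have hnn : 0 ≤ ∑ s', ‖reducedState A (elementaryState n d m) s s'‖ :=
    Finset.sum_nonneg fun _ _ => norm_nonneg _
  rw [← Real.norm_of_nonneg hnn, ← Complex.norm_real, hsum, norm_mul, Complex.norm_real,
    Real.norm_of_nonneg (by positivity), htot, Complex.norm_natCast]
  gcongr
  push_cast
  refine (norm_sum_le _ _).trans (Finset.sum_le_sum fun t _ => ?_)
  rw [hK, norm_mul, Complex.norm_natCast, norm_zpow, norm_omega hd, one_zpow, one_mul]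

/-- On the zero string the discarded phases are all `1`, so the bound for all rows is attained. -/
theorem sum_norm_reducedState_zero (hd : d ≠ 0) {A : Finset (Fin n)} (hA : IsBipartition A) :
    ∑ s', ‖reducedState A (elementaryState n d m) (fun _ => ⟨0, Nat.pos_of_ne_zero hd⟩) s'‖ =
      ((d : ℝ) ^ n)⁻¹ * ‖∑ q : Str (Fin n) d, omega d ^ (-(m : ℤ) * ∏ i, ((q i : ℕ) : ℤ))‖ := by
  obtain ⟨i, hi⟩ := hA.1
  have hsum : ((∑ s', ‖reducedState A (elementaryState n d m)
        (fun _ => ⟨0, Nat.pos_of_ne_zero hd⟩) s'‖ : ℝ) : ℂ) =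
      ((((d : ℝ) ^ n)⁻¹ : ℝ) : ℂ) *
        ∑ q : Str (Fin n) d, omega d ^ (-(m : ℤ) * ∏ i, ((q i : ℕ) : ℤ)) := by
    rw [Complex.ofReal_sum]
    simp only [norm_reducedState_elementaryState hd hA]
    simp only [reducedState_elementaryState_apply hd, ← Finset.mul_sum]
    rw [sum_str_eq_sum_glue A]
    congr 1
    refine Finset.sum_congr rfl fun s' _ => Finset.sum_congr rfl fun t _ => ?_
    rw [prod_glue, Finset.prod_eq_zero (Finset.mem_univ (⟨i, hi⟩ : {i // i ∈ A})) (by simp)]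
    congr 1
    ring
  have hnn : 0 ≤ ∑ s', ‖reducedState A (elementaryState n d m)
        (fun _ => ⟨0, Nat.pos_of_ne_zero hd⟩) s'‖ :=
    Finset.sum_nonneg fun _ _ => norm_nonneg _
  rw [← Real.norm_of_nonneg hnn, ← Complex.norm_real, hsum, norm_mul, Complex.norm_real,
    Real.norm_of_nonneg (by positivity)]

theorem infNorm_reducedState_elementaryState (hd : d ≠ 0) {A : Finset (Fin n)}
    (hA : IsBipartition A) :
    infNorm (reducedState A (elementaryState n d m)) = alphaFormula n d m := by
  obtain ⟨N, rfl⟩ : ∃ N, n = N + 1 := by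
    obtain ⟨i, -⟩ := hA.1
    exact ⟨n - 1, by have := i.2; omega⟩
  have hval : ((d : ℝ) ^ (N + 1))⁻¹ *
      ‖∑ q : Str (Fin (N + 1)) d, omega d ^ (-(m : ℤ) * ∏ i, ((q i : ℕ) : ℤ))‖ =
      alphaFormula (N + 1) d m := by
    have hd' : (d : ℝ) ≠ 0 := by exact_mod_cast hd
    rw [sum_omega_zpow_prod_fin hd, Complex.norm_natCast, dvdCount_neg, Nat.cast_mul,
      dvdCount_eq_alphaFormula hd, pow_succ]
    field_simp
  have : Nonempty (Str {i // i ∈ A} d) := ⟨fun _ => ⟨0, Nat.pos_of_ne_zero hd⟩⟩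
  refine le_antisymm (ciSup_le fun s => (sum_norm_reducedState_le hd hA s).trans_eq hval) ?_
  rw [← hval, ← sum_norm_reducedState_zero hd hA]
  exact le_ciSup (f := fun s => ∑ s', ‖reducedState A (elementaryState (N + 1) d m) s s'‖)
    (Set.finite_range _).bddAbove _

end ReducedState

/-! ### Attainment on one-qudit cuts -/

section OneQuditCut

variable {N d m : ℕ} (v : Fin (N + 1))

/-- The strings on the qudits other than `v` whose product is annihilated by `m` modulo `d`. -/
def annihilatedStrings (d m : ℕ) (v : Fin (N + 1)) :
    Finset (Str {i // i ∈ ({v}ᶜ : Finset (Fin (N + 1)))} d) :=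
  Finset.univ.filter fun s => (d : ℤ) ∣ m * ∏ i, ((s i : ℕ) : ℤ)

theorem card_compl_subtype :
    Fintype.card {i // i ∉ ({v}ᶜ : Finset (Fin (N + 1)))} = 0 + 1 := by
  simp

theorem sum_elementaryState_glue (hd : d ≠ 0)
    (s : Str {i // i ∈ ({v}ᶜ : Finset (Fin (N + 1)))} d) :
    ∑ t, elementaryState (N + 1) d m (glue {v}ᶜ s t) =
      (((Real.sqrt d)⁻¹ ^ (N + 1) : ℝ) : ℂ) *
        if s ∈ annihilatedStrings d m v then (d : ℂ) else 0 := by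
  simp only [elementaryState_apply, prod_glue, ← mul_assoc, ← Finset.mul_sum]
  rw [sum_omega_zpow_prod hd (card_compl_subtype v), dvdCount_zero]
  simp only [annihilatedStrings, Finset.mem_filter, Finset.mem_univ, true_and]
  split_ifs <;> simp

/-- The same exponential sum is evaluated twice, over all qudits and with `v` summed first, which
avoids transporting the count between index types. -/
theorem card_annihilatedStrings (hd : d ≠ 0) :
    ((annihilatedStrings d m v).card : ℝ) = (d : ℝ) ^ N * alphaFormula (N + 1) d m := by
  rw [← dvdCount_eq_alphaFormula hd]
  have h : ((d * dvdCount d d N m : ℕ) : ℂ) = ((d * (annihilatedStrings d m v).card : ℕ) : ℂ) := by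
    rw [← sum_omega_zpow_prod_fin hd, sum_str_eq_sum_glue {v}ᶜ]
    simp only [prod_glue, ← mul_assoc]
    rw [Finset.sum_congr rfl fun s _ => sum_omega_zpow_prod hd (card_compl_subtype v) _]
    simp only [dvdCount_zero, annihilatedStrings, Finset.card_filter]
    push_cast
    rw [Finset.mul_sum]
  have h' := Nat.eq_of_mul_eq_mul_left (Nat.pos_of_ne_zero hd) (Nat.cast_injective h)
  rw [h']

theorem card_annihilatedStrings_pos (hd : d ≠ 0) (hN : N ≠ 0) :
    0 < (annihilatedStrings d m v).card := by
  refine Finset.card_pos.2 ⟨fun _ => ⟨0, Nat.pos_of_ne_zero hd⟩, ?_⟩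
  have : Nontrivial (Fin (N + 1)) := Fin.nontrivial_iff_two_le.2 (by omega)
  obtain ⟨w, hw⟩ := exists_ne v
  have hw' : w ∈ ({v}ᶜ : Finset (Fin (N + 1))) := by simpa using hw
  have h0 : ∏ i : {i // i ∈ ({v}ᶜ : Finset (Fin (N + 1)))},
      (((⟨0, Nat.pos_of_ne_zero hd⟩ : Fin d) : ℕ) : ℤ) = 0 :=
    Finset.prod_eq_zero (Finset.mem_univ ⟨w, hw'⟩) (by simp)
  simp only [annihilatedStrings, Finset.mem_filter, Finset.mem_univ, true_and]
  rw [h0, mul_zero]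
  exact dvd_zero _

theorem isBipartition_compl_singleton (hN : N ≠ 0) :
    IsBipartition ({v}ᶜ : Finset (Fin (N + 1))) := by
  have : Nontrivial (Fin (N + 1)) := Fin.nontrivial_iff_two_le.2 (by omega)
  obtain ⟨w, hw⟩ := exists_ne v
  exact ⟨⟨w, by simpa using hw⟩, ⟨v, by simp⟩⟩

theorem alphaFormula_mem_cutOverlaps (hd : d ≠ 0) (hN : N ≠ 0) :
    alphaFormula (N + 1) d m ∈ cutOverlaps {v}ᶜ (elementaryState (N + 1) d m) := by
  set K := (annihilatedStrings d m v).card with hK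
  have hKpos : (0 : ℝ) < K := by exact_mod_cast card_annihilatedStrings_pos v hd hN
  have hd' : (0 : ℝ) < d := by exact_mod_cast Nat.pos_of_ne_zero hd
  -- The optimal product vector: `b = |+⟩`, and `a` is the normalised contraction of the state with
  -- it. The squared overlap is `K / d ^ N`.
  set a : Hilb {i // i ∈ ({v}ᶜ : Finset (Fin (N + 1)))} d := WithLp.toLp 2 fun s =>
    if s ∈ annihilatedStrings d m v then (((Real.sqrt K)⁻¹ : ℝ) : ℂ) else 0 with ha
  set b : Hilb {i // i ∉ ({v}ᶜ : Finset (Fin (N + 1)))} d := WithLp.toLp 2 fun _ =>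
    (((Real.sqrt d)⁻¹ : ℝ) : ℂ) with hb
  have hsqK : (Real.sqrt K)⁻¹ ^ 2 * K = 1 := by
    rw [inv_pow, Real.sq_sqrt hKpos.le, inv_mul_cancel₀ hKpos.ne']
  have hsqd : (Real.sqrt d)⁻¹ ^ 2 * d = 1 := by
    rw [inv_pow, Real.sq_sqrt hd'.le, inv_mul_cancel₀ hd'.ne']
  refine ⟨tensor {v}ᶜ a b, ⟨a, b, ?_, ?_, rfl⟩, ?_⟩
  · rw [EuclideanSpace.norm_eq, Real.sqrt_eq_one, ← hsqK]
    have : ∀ s, ‖a s‖ ^ 2 =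
        if s ∈ annihilatedStrings d m v then (Real.sqrt K)⁻¹ ^ 2 else 0 := fun s => by
      simp only [ha]
      split_ifs <;> simp
    rw [Finset.sum_congr rfl fun s _ => this s, Finset.sum_ite_mem, Finset.univ_inter,
      Finset.sum_const, nsmul_eq_mul, mul_comm]
  · rw [EuclideanSpace.norm_eq, Real.sqrt_eq_one, ← hsqd]
    simp [hb, mul_comm]
  · have hin : inner ℂ (tensor {v}ᶜ a b) (elementaryState (N + 1) d m) =
        (((Real.sqrt K)⁻¹ * K * (Real.sqrt d)⁻¹ ^ (N + 2) * d : ℝ) : ℂ) := by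
      rw [inner_tensor]
      have : ∀ s, ∑ t, (starRingEnd ℂ) (a s) * (starRingEnd ℂ) (b t) *
          elementaryState (N + 1) d m (glue {v}ᶜ s t) =
          if s ∈ annihilatedStrings d m v then
            (((Real.sqrt K)⁻¹ * (Real.sqrt d)⁻¹ ^ (N + 2) * d : ℝ) : ℂ) else 0 := fun s => by
        simp only [hb, Complex.conj_ofReal]
        rw [← Finset.mul_sum, sum_elementaryState_glue v hd]
        by_cases hs : s ∈ annihilatedStrings d m v
        · simp only [ha, if_pos hs, Complex.conj_ofReal]
          push_cast
          ring
        · simp [hs]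
      rw [Finset.sum_congr rfl fun s _ => this s, Finset.sum_ite_mem, Finset.univ_inter,
        Finset.sum_const, nsmul_eq_mul, ← hK]
      push_cast
      ring
    have hcard := card_annihilatedStrings (m := m) v hd
    rw [← hK] at hcard
    rw [hin, Complex.norm_real, Real.norm_of_nonneg (by positivity)]
    have h2 : ((Real.sqrt K)⁻¹ * K * (Real.sqrt d)⁻¹ ^ (N + 2) * d) ^ 2 =
        ((Real.sqrt K)⁻¹ ^ 2 * K) * ((Real.sqrt d)⁻¹ ^ 2 * d) ^ 2 *
          (((Real.sqrt d)⁻¹ ^ 2) ^ N * K) := by ring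
    have h3 : ((Real.sqrt d)⁻¹ ^ 2) ^ N * (d : ℝ) ^ N = 1 := by
      rw [← mul_pow, hsqd, one_pow]
    rw [h2, hsqK, hsqd, hcard]
    linear_combination (-alphaFormula (N + 1) d m) * h3

theorem isGreatest_cutOverlaps (hd : d ≠ 0) (hN : N ≠ 0) :
    IsGreatest (cutOverlaps {v}ᶜ (elementaryState (N + 1) d m)) (alphaFormula (N + 1) d m) := by
  refine ⟨alphaFormula_mem_cutOverlaps v hd hN, ?_⟩
  rintro x ⟨φ, hφ, rfl⟩
  rw [← infNorm_reducedState_elementaryState hd (isBipartition_compl_singleton v hN)]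
  exact overlap_le_infNorm _ _ hφ

/-- `M` sends the constant vector to a constant on the annihilated strings, and the rows of `M` at
those strings are constant because every phase is `1`. So `M†` returns a constant vector, with
eigenvalue `K / d ^ N`. -/
theorem adjoint_coeffMatrix_apply_one (hd : d ≠ 0) :
    LinearMap.adjoint (Matrix.toEuclideanLin (coeffMatrix {v}ᶜ (elementaryState (N + 1) d m)))
      (Matrix.toEuclideanLin (coeffMatrix {v}ᶜ (elementaryState (N + 1) d m))
        (WithLp.toLp 2 fun _ => 1)) =
      ((alphaFormula (N + 1) d m : ℝ) : ℂ) • (WithLp.toLp 2 fun _ => 1) := by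
  have hd' : (0 : ℝ) < d := by exact_mod_cast Nat.pos_of_ne_zero hd
  rw [← Matrix.toEuclideanLin_conjTranspose_eq_adjoint]
  ext t
  rw [Matrix.toLpLin_apply]
  simp only [Matrix.mulVec, dotProduct, Matrix.conjTranspose_apply,
    toEuclideanLin_coeffMatrix_apply, mul_one, sum_elementaryState_glue v hd]
  have : ∀ s, star (coeffMatrix {v}ᶜ (elementaryState (N + 1) d m) s t) *
      ((((Real.sqrt d)⁻¹ ^ (N + 1) : ℝ) : ℂ) *
        if s ∈ annihilatedStrings d m v then (d : ℂ) else 0) =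
      if s ∈ annihilatedStrings d m v then ((((d : ℝ) ^ (N + 1))⁻¹ * d : ℝ) : ℂ) else 0 := by
    intro s
    by_cases hs : s ∈ annihilatedStrings d m v
    · have hdvd := (Finset.mem_filter.1 hs).2
      simp only [if_pos hs, coeffMatrix, Matrix.of_apply, elementaryState_apply, prod_glue,
        ← mul_assoc]
      rw [((omega_isPrimitiveRoot hd).zpow_eq_one_iff_dvd _).2 (hdvd.mul_right _), mul_one,
        ← inv_sqrt_pow_mul_self, RCLike.star_def, Complex.conj_ofReal]
      push_cast
      rfl
    · simp [hs]
  rw [Finset.sum_congr rfl fun s _ => this s, Finset.sum_ite_mem, Finset.univ_inter,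
    Finset.sum_const, nsmul_eq_mul, ← Complex.ofReal_natCast, card_annihilatedStrings v hd,
    ← Complex.ofReal_mul]
  simp only [PiLp.smul_apply, smul_eq_mul, mul_one]
  congr 1
  rw [pow_succ]
  field_simp

theorem sq_maxSchmidtCoeff (hd : d ≠ 0) (hN : N ≠ 0) :
    maxSchmidtCoeff {v}ᶜ (elementaryState (N + 1) d m) ^ 2 = alphaFormula (N + 1) d m := by
  have hinf := infNorm_reducedState_elementaryState (m := m) hd (isBipartition_compl_singleton v hN)
  refine le_antisymm (sq_singularValues_zero_le _ ?_ fun b => ?_)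
    (le_sq_singularValues_zero _ ?_ (adjoint_coeffMatrix_apply_one v hd))
  · rw [← hinf]
    exact Real.iSup_nonneg fun i => Finset.sum_nonneg fun j _ => norm_nonneg _
  · rw [← hinf]
    exact norm_toEuclideanLin_coeffMatrix_sq_le _ _ b
  · intro h
    have := congrArg (fun x : Hilb {i // i ∉ ({v}ᶜ : Finset (Fin (N + 1)))} d =>
      x fun _ => ⟨0, Nat.pos_of_ne_zero hd⟩) h
    simp at this

theorem isGreatest_biseparableOverlaps (hd : d ≠ 0) (hN : N ≠ 0) :
    IsGreatest (biseparableOverlaps (elementaryState (N + 1) d m))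
      (alphaFormula (N + 1) d m) := by
  constructor
  · obtain ⟨φ, hφ, h⟩ := alphaFormula_mem_cutOverlaps (m := m) (0 : Fin (N + 1)) hd hN
    exact ⟨φ, ⟨_, isBipartition_compl_singleton 0 hN, hφ⟩, h⟩
  · rintro x ⟨φ, ⟨A, hA, hφ⟩, rfl⟩
    rw [← infNorm_reducedState_elementaryState hd hA]
    exact overlap_le_infNorm _ _ hφ

theorem multipartiteEntanglement_elementaryState (hd : d ≠ 0) (hN : N ≠ 0) :
    multipartiteEntanglement (elementaryState (N + 1) d m) = 1 - alphaFormula (N + 1) d m := by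
  -- `Real.sSup_le` asks for a nonnegative bound in place of non-emptiness of the set.
  have h0 : 0 ≤ alphaFormula (N + 1) d m := by
    rw [← sq_maxSchmidtCoeff 0 hd hN]
    positivity
  have hle : ∀ A : {A : Finset (Fin (N + 1)) // IsBipartition A},
      1 - alphaFormula (N + 1) d m ≤ bipartiteEntanglement A.1 (elementaryState (N + 1) d m) := by
    rintro ⟨A, hA⟩
    refine sub_le_sub_left (Real.sSup_le ?_ h0) 1
    rintro x ⟨φ, hφ, rfl⟩
    exact (isGreatest_biseparableOverlaps hd hN).2 ⟨φ, ⟨A, hA, hφ⟩, rfl⟩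
  have hA := isBipartition_compl_singleton (0 : Fin (N + 1)) hN
  have : Nonempty {A : Finset (Fin (N + 1)) // IsBipartition A} := ⟨⟨_, hA⟩⟩
  refine le_antisymm ((ciInf_le ⟨_, Set.forall_mem_range.2 hle⟩ ⟨_, hA⟩).trans_eq ?_) (le_ciInf hle)
  rw [bipartiteEntanglement, (isGreatest_cutOverlaps 0 hd hN).csSup_eq]

end OneQuditCut

end QuditHypergraph

end

/-- The maximal squared overlap of the elementary hypergraph state with the pure biseparable states
and its multipartite entanglement. The last three clauses say that every cut into `n - 1` qudits
and one qudit is optimal, and that its largest squared Schmidt coefficient equals the infinity norm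
of the reduced state of every proper non-empty set of qudits. -/
theorem theorem2 (n d m : ℕ) (hn : 2 ≤ n) (hd : 2 ≤ d) :
    IsGreatest (QuditHypergraph.biseparableOverlaps (QuditHypergraph.elementaryState n d m))
      (QuditHypergraph.alphaFormula n d m) ∧
    QuditHypergraph.multipartiteEntanglement (QuditHypergraph.elementaryState n d m) =
      1 - QuditHypergraph.alphaFormula n d m ∧
    (∀ v : Fin n,
      IsGreatest (QuditHypergraph.cutOverlaps {v}ᶜ (QuditHypergraph.elementaryState n d m))
        (QuditHypergraph.alphaFormula n d m)) ∧
    (∀ v : Fin n,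
      QuditHypergraph.maxSchmidtCoeff {v}ᶜ (QuditHypergraph.elementaryState n d m) ^ 2 =
        QuditHypergraph.alphaFormula n d m) ∧
    (∀ A : Finset (Fin n), QuditHypergraph.IsBipartition A →
      QuditHypergraph.infNorm
          (QuditHypergraph.reducedState A (QuditHypergraph.elementaryState n d m)) =
        QuditHypergraph.alphaFormula n d m) := by
  obtain ⟨N, rfl⟩ : ∃ N, n = N + 1 := ⟨n - 1, by omega⟩
  have hN : N ≠ 0 := by omega
  have hd0 : d ≠ 0 := by omega
  exact ⟨QuditHypergraph.isGreatest_biseparableOverlaps hd0 hN,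
    QuditHypergraph.multipartiteEntanglement_elementaryState hd0 hN,
    fun v => QuditHypergraph.isGreatest_cutOverlaps v hd0 hN,
    fun v => QuditHypergraph.sq_maxSchmidtCoeff v hd0 hN,
    fun _ hA => QuditHypergraph.infNorm_reducedState_elementaryState hd0 hA⟩
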